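/- Let $f:\mathbb{R}^n\to(-\infty,+\infty]$ and $g:\mathbb{R}^m\to(-\infty,+\infty]$ be proper, closed and convex, let $f$ be $\sigma$-strongly convex with $\sigma>0$, and let $A$ be a real $m\times n$ matrix. Norms are Euclidean (spectral for $A$). Put $H(x)=f(x)+g(Ax)$ and $\tilde H(x,z)=f(x)+g(z)$, and consider the problems $$(P)\quad \min_x H(x),\qquad\qquad (P')\quad \min_{x,z}\{\tilde H(x,z): Ax-z=0\}.$$ Let $q(y)=\inf_{x,z}\{\tilde H(x,z)-\langle y,Ax-z\rangle\}$ be the dual function and suppose that it has a maximizer; let $y_*$ be any maximizer. Put $F(y)=f^*(A^\top y)$, $G(y)=g^*(-y)$ (convex conjugates), $\tilde q=F+G$, $L_F=\|A\|^2/\sigma$, and for $L>0$ $$Q_L(y,w)=F(w)+\langle y-w,\nabla F(w)\rangle+\tfrac L2\|y-w\|^2+G(y),\qquad p_L(w)=\operatorname{argmin}_y Q_L(y,w).$$ Say that $L$ is admissible at $w$ if $\tilde q(p_L(w))\le Q_L(p_L(w),w)$. Let $x(y)=\operatorname{argmax}_x\{\langle A^\top y,x\rangle-f(x)\}$. At a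 point $p_L(w)$, let $z(p_L(w)):=Ax(w)+L(p_L(w)-w)$. Let $a>2$, $t_k=\frac{k+a}{a}$ and $T_k=\sum_{i=0}^k t_i$. Let $\{y_k,w_k\}$ be generated by the generalized fast dual-based proximal gradient method (GFDPG): $y_0=w_0$ is arbitrary, $L_0>0$, and for each $k\ge1$ a number $L_k\ge L_{k-1}$ admissible at $w_{k-1}$ is chosen and $$y_k=p_{L_k}(w_{k-1}),\qquad w_k=y_k+\frac{(T_{k-1}-t_{k-1})t_k}{t_{k-1}T_k}(y_k-y_{k-1})+\frac{(t_{k-1}^2-T_{k-1})t_k}{t_{k-1}T_k}(y_k-w_{k-1}).$$ In particular $z(y_i)=Ax(w_{i-1})+L_i(y_i-w_{i-1})$ for $i\ge1$. Let $k\ge1$, let $L_k'\ge L_k$ be admissible at $y_k$, and put $p=p_{L_k'}(y_k)$. Then the vectors $z(y_1),\dots,z(y_k)$ and $z(p)$ (the last one formed with $w=y_k$, $L=L_k'$) satisfy $z(y_i)\in\operatorname{argmin}_z\{\langle y_i,z\rangle+g(z)\}$ and $z(p)\in\operatorname{argmin}_z\{\langle p,z\rangle+g(z)\}$, and $$\min\Big\{\min_{1\le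 i\le k}\big[\tilde H(x(y_i),z(y_i))-q(y_i)\big],\ \tilde H(x(p),z(p))-q(p)\Big\}\le\frac{a\sqrt6}{\sqrt{a-2}}\,(L_k'+L_F)\,\big(\|y_0-y_*\|+\|y_*\|\big)\frac{\|y_0-y_*\|}{k^{1.5}}.$$ If moreover $g$ is subdifferentiable at every $z\in\mathbb{R}^m$ and $\gamma_g:=\sup\{\|d\|: z\in\mathbb{R}^m,\ d\in\partial g(z)\}<\infty$, then $$\min\Big\{\min_{1\le i\le k}\big[H(x(y_i))-q(y_i)\big],\ H(x(p))-q(p)\Big\}\le\frac{a\sqrt6}{\sqrt{a-2}}\,(L_k'+L_F)\,\big(\|y_0-y_*\|+\|y_*\|+\gamma_g\big)\frac{\|y_0-y_*\|}{k^{1.5}}.$$ -/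

import Mathlib

open scoped InnerProductSpace

noncomputable section

/-- A chosen minimizer of `φ` (unspecified when `φ` has no minimizer). -/
def argminOf {X : Type*} [Nonempty X] (φ : X → EReal) : X :=
  Classical.epsilon fun x => IsMinOn φ Set.univ x

/-- A chosen maximizer of `φ` (unspecified when `φ` has no maximizer). -/
def argmaxOf {X : Type*} [Nonempty X] (φ : X → EReal) : X :=
  Classical.epsilon fun x => IsMaxOn φ Set.univ x

section Convexity

variable {E : Type*} [NormedAddCommGroup E] [InnerProductSpace ℝ E]

/-- A function with values in `(-∞, +∞]` that is not identically `+∞`. -/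
def IsProperFun (f : E → EReal) : Prop :=
  (∀ x, f x ≠ ⊥) ∧ ∃ x, f x ≠ ⊤

/-- Convexity of a function with values in `(-∞, +∞]`. -/
def IsConvexFun (f : E → EReal) : Prop :=
  ∀ (x y : E) (a b : ℝ), 0 < a → 0 < b → a + b = 1 →
    f (a • x + b • y) ≤ (a : EReal) * f x + (b : EReal) * f y

/-- `σ`-strong convexity of a function with values in `(-∞, +∞]`. -/
def IsStronglyConvexFun (σ : ℝ) (f : E → EReal) : Prop :=
  ∀ (x y : E) (a b : ℝ), 0 < a → 0 < b → a + b = 1 →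
    f (a • x + b • y) + ((σ / 2 * a * b * ‖x - y‖ ^ 2 : ℝ) : EReal) ≤
      (a : EReal) * f x + (b : EReal) * f y

/-- The convex conjugate `f*(u) = sup_x {⟨u, x⟩ - f(x)}`. -/
def convexConj (f : E → EReal) (u : E) : EReal :=
  ⨆ x, ((⟪u, x⟫_ℝ : ℝ) : EReal) - f x

/-- The subdifferential `∂f(x)`. -/
def subdiff (f : E → EReal) (x : E) : Set E :=
  {d | ∀ u, f x + ((⟪d, u - x⟫_ℝ : ℝ) : EReal) ≤ f u}

/-- The set of norms of all subgradients of `f`, at all points. -/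
def subgradNorms (f : E → EReal) : Set ℝ :=
  {r | ∃ x, ∃ d ∈ subdiff f x, ‖d‖ = r}

/-- `f` is subdifferentiable everywhere and its subgradients are bounded. -/
def HasBoundedSubgradients (f : E → EReal) : Prop :=
  (∀ x, (subdiff f x).Nonempty) ∧ BddAbove (subgradNorms f)

/-- `γ_f`, the supremum of the norms of the subgradients of `f`. -/
def subgradBound (f : E → EReal) : ℝ :=
  sSup (subgradNorms f)

end Convexity

section Duality

variable {E V : Type*} [NormedAddCommGroup E] [InnerProductSpace ℝ E] [CompleteSpace E]
  [NormedAddCommGroup V] [InnerProductSpace ℝ V] [CompleteSpace V]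

/-- The primal objective `H(x) = f(x) + g(Ax)`. -/
def primalObj (f : E → EReal) (g : V → EReal) (A : E →L[ℝ] V) (x : E) : EReal :=
  f x + g (A x)

/-- The objective `f(x) + g(z)` of the split problem, whose constraint is `Ax - z = 0`. -/
def splitObj (f : E → EReal) (g : V → EReal) (x : E) (z : V) : EReal :=
  f x + g z

/-- The dual function `q(y) = inf_{x,z} {f(x) + g(z) - ⟨y, Ax - z⟩}`. -/
def dualFun (f : E → EReal) (g : V → EReal) (A : E →L[ℝ] V) (y : V) : EReal :=
  ⨅ (x : E) (z : V), splitObj f g x z - ((⟪y, A x - z⟫_ℝ : ℝ) : EReal)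

/-- `F(y) = f*(Aᵀy)`. -/
def dualF (f : E → EReal) (A : E →L[ℝ] V) (y : V) : EReal :=
  convexConj f (ContinuousLinearMap.adjoint A y)

/-- `G(y) = g*(-y)`. -/
def dualG (g : V → EReal) (y : V) : EReal :=
  convexConj g (-y)

/-- `F(y) + G(y)`, the objective of the dual problem as a minimization problem. -/
def dualObj (f : E → EReal) (g : V → EReal) (A : E →L[ℝ] V) (y : V) : EReal :=
  dualF f A y + dualG g y

/-- `∇F(y)`; `F` is finite everywhere when `f` is proper, closed and strongly convex. -/
def gradF (f : E → EReal) (A : E →L[ℝ] V) (y : V) : V :=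
  gradient (fun v => (dualF f A v).toReal) y

/-- The quadratic model
`Q_L(y, w) = F(w) + ⟨y - w, ∇F(w)⟩ + (L/2)‖y - w‖² + G(y)`. -/
def quadModel (f : E → EReal) (g : V → EReal) (A : E →L[ℝ] V) (L : ℝ) (y w : V) : EReal :=
  dualF f A w + ((⟪y - w, gradF f A w⟫_ℝ + L / 2 * ‖y - w‖ ^ 2 : ℝ) : EReal) + dualG g y

/-- The proximal gradient update `p_L(w) = argmin_y Q_L(y, w)`. -/
def proxGrad (f : E → EReal) (g : V → EReal) (A : E →L[ℝ] V) (L : ℝ) (w : V) : V :=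
  argminOf fun y => quadModel f g A L y w

/-- The backtracking condition `(F + G)(p_L(w)) ≤ Q_L(p_L(w), w)`. -/
def BacktrackCond (f : E → EReal) (g : V → EReal) (A : E →L[ℝ] V) (L : ℝ) (w : V) : Prop :=
  dualObj f g A (proxGrad f g A L w) ≤ quadModel f g A L (proxGrad f g A L w) w

/-- The primal vector `x(y) = argmax_x {⟨Aᵀy, x⟩ - f(x)}`. -/
def primalX (f : E → EReal) (A : E →L[ℝ] V) (y : V) : E :=
  argmaxOf fun x => ((⟪ContinuousLinearMap.adjoint A y, x⟫_ℝ : ℝ) : EReal) - f x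

/-- `z` is a valid choice of the primal vector `z(y) ∈ argmin_z {⟨y, z⟩ + g(z)}`. -/
def IsPrimalZ (g : V → EReal) (y z : V) : Prop :=
  IsMinOn (fun z => ((⟪y, z⟫_ℝ : ℝ) : EReal) + g z) Set.univ z

/-- The choice of `z(p_L(w))` that comes with the update `p_L(w)`: the vector `z` with
`A x(w) - z + L (p_L(w) - w) = 0`. -/
def proxZ (f : E → EReal) (g : V → EReal) (A : E →L[ℝ] V) (L : ℝ) (w : V) : V :=
  A (primalX f A w) + L • (proxGrad f g A L w - w)

/-- `T_k = t_0 + ⋯ + t_k`. -/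
def partialT (t : ℕ → ℝ) (k : ℕ) : ℝ :=
  ∑ i ∈ Finset.range (k + 1), t i

/-- `{y_k, w_k}` is generated by the generalized fast dual-based proximal gradient method with
backtracking, with parameters `t_k` and constants `L_k`. -/
structure IsGFDPG (f : E → EReal) (g : V → EReal) (A : E →L[ℝ] V)
    (t L : ℕ → ℝ) (y w : ℕ → V) : Prop where
  w_zero : w 0 = y 0
  L_zero_pos : 0 < L 0
  t_zero : 0 < t 0 ∧ t 0 ≤ 1
  L_le : ∀ k, L k ≤ L (k + 1)
  backtrack : ∀ k, BacktrackCond f g A (L (k + 1)) (w k)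
  y_succ : ∀ k, y (k + 1) = proxGrad f g A (L (k + 1)) (w k)
  t_pos : ∀ k, 0 < t (k + 1)
  t_sq_le : ∀ k, t (k + 1) ^ 2 ≤ partialT t (k + 1)
  w_succ : ∀ k, w (k + 1) = y (k + 1)
    + ((partialT t k - t k) * t (k + 1) / (t k * partialT t (k + 1))) • (y (k + 1) - y k)
    + ((t k ^ 2 - partialT t k) * t (k + 1) / (t k * partialT t (k + 1))) • (y (k + 1) - w k)

end Duality

end

/-! At a proximal point p = p_L(w) the vector z = Ax(w) + L(p - w) satisfies -p ∈ ∂g(z)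
(`proxGrad_spec`). Hence (x(p), z) attains the infimum defining q(p), and the split duality gap is
exactly ⟨p, Ax(p) - z⟩. Since ∇F = A x(·) is L_F-Lipschitz (`gradF_eq`, `norm_map_primalX_sub_le`),
the residual Ax(p) - z has norm at most (L + L_F)‖p - w‖. It remains to keep ‖p‖ bounded and to find
one short proximal step.

Both come from a potential (`accelerated_potential`) that retains the terms (T_i - t_i²)‖y_{i+1} -
w_i‖² usually thrown away. It keeps an auxiliary sequence within ‖y_0 - y_*‖ of y_*, and the
iterates inherit this bound because w_k is a convex combination of y_k and that sequence. The
remaining dual-value term pays for one extra step from y_k, with weight T_{k-1}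
(`accelerated_steps_sum_le`). For t_k = (k + a)/a the weights add up to at least (a - 2)k³/(6a²), so
some step is at most a√6/√(a - 2) · ‖y_0 - y_*‖/k^{1.5} (`exists_short_step`). For H, a subgradient
of g at Ax(p) allows z to be replaced by Ax(p), at the price of γ_g. -/

theorem lowerSemicontinuous_add_coe {E : Type*} [TopologicalSpace E]
    {φ : E → EReal} (hφ : LowerSemicontinuous φ) {h : E → ℝ}
    (hh : Continuous h) : LowerSemicontinuous (fun x => φ x + (h x : EReal)) :=
  hφ.add' (continuous_coe_real_ereal.comp hh).lowerSemicontinuous fun _ =>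
    EReal.continuousAt_add (Or.inr (EReal.coe_ne_bot _)) (Or.inr (EReal.coe_ne_top _))

theorem IsProperFun.add_coe {E : Type*} {φ : E → EReal} (hφ : IsProperFun φ) (h : E → ℝ) :
    IsProperFun (fun x => φ x + (h x : EReal)) := by
  obtain ⟨h1, x, hx⟩ := hφ
  refine ⟨fun x => ?_, x, ?_⟩
  · simp [EReal.add_eq_bot_iff, h1]
  · exact EReal.add_ne_top hx (EReal.coe_ne_top _)

/-! ### Strongly convex extended-valued functions and conjugates -/

section Convexity

variable {E : Type*} [NormedAddCommGroup E] [InnerProductSpace ℝ E]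

theorem IsConvexFun.isStronglyConvexFun_zero {φ : E → EReal} (h : IsConvexFun φ) :
    IsStronglyConvexFun 0 φ := by
  intro x y a b ha hb hab
  simpa using h x y a b ha hb hab

/-- Adding a real-valued strongly convex function to a strongly convex function. -/
theorem IsStronglyConvexFun.add_coe {σ τ : ℝ} {φ : E → EReal} (hφ : IsStronglyConvexFun σ φ)
    {h : E → ℝ}
    (hh : ∀ (x y : E) (a b : ℝ), 0 < a → 0 < b → a + b = 1 →
      h (a • x + b • y) + τ / 2 * a * b * ‖x - y‖ ^ 2 ≤ a * h x + b * h y) :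
    IsStronglyConvexFun (σ + τ) (fun x => φ x + (h x : EReal)) := by
  intro x y a b ha hb hab
  have h1 := hφ x y a b ha hb hab
  have h2 : ((h (a • x + b • y) + τ / 2 * a * b * ‖x - y‖ ^ 2 : ℝ) : EReal) ≤
    ((a * h x + b * h y : ℝ) : EReal) := EReal.coe_le_coe_iff.2 (hh x y a b ha hb hab)
  have h3 := add_le_add h1 h2
  have e1 : ((σ + τ) / 2 * a * b * ‖x - y‖ ^ 2 : ℝ) =
      σ / 2 * a * b * ‖x - y‖ ^ 2 + τ / 2 * a * b * ‖x - y‖ ^ 2 := by ring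
  have e2 : ∀ (c : ℝ), 0 < c → ∀ z, (c : EReal) * (φ z + (h z : EReal)) =
      (c : EReal) * φ z + ((c * h z : ℝ) : EReal) := by
    intro c hc z
    rw [EReal.left_distrib_of_nonneg_of_ne_top (by exact_mod_cast hc.le) (EReal.coe_ne_top _),
      EReal.coe_mul]
  simp only [e2 a ha, e2 b hb, e1]
  calc _ = φ (a • x + b • y) + ((σ / 2 * a * b * ‖x - y‖ ^ 2 : ℝ) : EReal) +
        ((h (a • x + b • y) + τ / 2 * a * b * ‖x - y‖ ^ 2 : ℝ) : EReal) := by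
        push_cast; abel
    _ ≤ _ := h3
    _ = _ := by push_cast; abel

theorem IsStronglyConvexFun.le_of_coe {σ : ℝ} {φ : E → EReal} (hφ : IsStronglyConvexFun σ φ)
    {x y : E} {r s m : ℝ} (hx : φ x ≤ r) (hy : φ y ≤ s) {b : ℝ} (hb : 0 < b) (hb1 : b < 1)
    (hm : (m : EReal) ≤ φ ((1 - b) • x + b • y)) :
    m + σ / 2 * (1 - b) * b * ‖x - y‖ ^ 2 ≤ (1 - b) * r + b * s := by
  have h := hφ x y (1 - b) b (by linarith) hb (by ring)
  have h2 : (((1 - b : ℝ) : EReal)) * φ x + (b : EReal) * φ y ≤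
      (((1 - b) * r + b * s : ℝ) : EReal) := by
    push_cast
    gcongr
    · exact_mod_cast (by linarith : (0 : ℝ) ≤ 1 - b)
  have h3 := (add_le_add_left hm ((σ / 2 * (1 - b) * b * ‖x - y‖ ^ 2 : ℝ) : EReal)).trans
    (h.trans h2)
  exact_mod_cast h3

/-- A strongly convex function grows quadratically around a minimizer. -/
theorem IsStronglyConvexFun.quadratic_growth {σ : ℝ} (hσ : 0 < σ) {φ : E → EReal}
    (hφ : IsStronglyConvexFun σ φ) {x : E} {r : ℝ} (hx : φ x = r) (hmin : ∀ u, φ x ≤ φ u) (u : E) :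
    ((r + σ / 2 * ‖u - x‖ ^ 2 : ℝ) : EReal) ≤ φ u := by
  induction hu : φ u with
  | bot => have := hmin u; rw [hu, hx] at this; simp at this
  | top => exact le_top
  | coe s =>
    rw [EReal.coe_le_coe_iff]
    set S := σ / 2 * ‖u - x‖ ^ 2 with hS
    have hS0 : 0 ≤ S := by positivity
    -- Strong convexity on the segment from `x` to `u`, divided by `b`; the claim is the limit b →
    -- 0, reached below with an explicit small `b`.
    have key : ∀ b : ℝ, 0 < b → b < 1 → r + (1 - b) * S ≤ s := by
      intro b hb hb1
      have := hφ.le_of_coe hx.le hu.le hb hb1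
        (hx.symm.le.trans (hmin _))
      rw [norm_sub_rev] at this
      have h2 : b * (r + (1 - b) * S) ≤ b * s := by rw [hS]; nlinarith
      exact le_of_mul_le_mul_left h2 hb
    by_contra! hlt
    have h1 := key (min (1 / 2) ((r + S - s) / (2 * (S + 1)))) (by
      have : 0 < (r + S - s) / (2 * (S + 1)) := div_pos (by linarith) (by linarith)
      positivity) (lt_of_le_of_lt (min_le_left _ _) (by norm_num))
    have h2 := min_le_right (1 / 2) ((r + S - s) / (2 * (S + 1)))
    have h3 : (r + S - s) / (2 * (S + 1)) * S ≤ (r + S - s) / 2 := by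
      rw [div_mul_eq_mul_div, div_le_iff₀ (by linarith)]
      nlinarith
    nlinarith [mul_le_mul_of_nonneg_right h2 hS0]

/-- A proper closed strongly convex function on a finite-dimensional space has a minimizer. -/
theorem IsStronglyConvexFun.exists_min [ProperSpace E] {σ : ℝ} (hσ : 0 < σ) {φ : E → EReal}
    (hφ : IsStronglyConvexFun σ φ) (hp : IsProperFun φ) (hc : LowerSemicontinuous φ) :
    ∃ (x : E) (r : ℝ), φ x = r ∧ ∀ u, φ x ≤ φ u := by
  obtain ⟨hbot, x₀, hx₀⟩ := hp
  lift φ x₀ to ℝ using ⟨hx₀, hbot x₀⟩ with c hc0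
  obtain ⟨x₁, -, hx₁⟩ := (hc.lowerSemicontinuousOn _).exists_isMinOn (s := Metric.closedBall x₀ 1)
    ⟨x₀, by simp⟩ (isCompact_closedBall x₀ 1)
  have hm1 : φ x₁ ≤ c := hc0 ▸ hx₁ (by simp)
  lift φ x₁ to ℝ using ⟨ne_top_of_le_ne_top (EReal.coe_ne_top _) hm1, hbot x₁⟩ with m hm
  have hmc : m ≤ c := by exact_mod_cast hm1
  -- Beyond this radius the quadratic term outweighs the possible drop c - m inside the unit ball,
  -- so values there are at least φ(x₀) = c.
  set R : ℝ := 2 + 2 * (c - m) / σ with hR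
  have hR2 : 2 ≤ R := by
    have : 0 ≤ 2 * (c - m) / σ := by
      apply div_nonneg _ hσ.le; linarith
    linarith
  obtain ⟨x₂, -, hx₂⟩ := (hc.lowerSemicontinuousOn _).exists_isMinOn (s := Metric.closedBall x₀ R)
    ⟨x₀, by simp; linarith⟩ (isCompact_closedBall x₀ R)
  have hm2 : φ x₂ ≤ c := hc0 ▸ hx₂ (by simp; linarith)
  refine ⟨x₂, (φ x₂).toReal, (EReal.coe_toReal
    (ne_top_of_le_ne_top (EReal.coe_ne_top _) hm2) (hbot x₂)).symm, fun u => ?_⟩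
  by_cases hu : ‖u - x₀‖ ≤ R
  · exact hx₂ (by simpa [dist_eq_norm] using hu)
  push Not at hu
  refine hm2.trans ?_
  induction hus : φ u with
  | bot => exact absurd hus (hbot u)
  | top => exact le_top
  | coe s =>
    rw [EReal.coe_le_coe_iff]
    set ρ := ‖u - x₀‖ with hρ
    have hρ0 : 0 < ρ := by linarith
    -- The segment from `x₀` to `u` meets the unit sphere here, where `φ` is at least `m`.
    have hmem : (1 - 1 / ρ) • x₀ + (1 / ρ) • u ∈ Metric.closedBall x₀ 1 := by
      have : (1 - 1 / ρ) • x₀ + (1 / ρ) • u - x₀ = (1 / ρ) • (u - x₀) := by module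
      rw [mem_closedBall_iff_norm, this, norm_smul, ← hρ, Real.norm_of_nonneg (by positivity)]
      field_simp; exact le_rfl
    have h1 := hφ.le_of_coe hc0.symm.le hus.le (b := 1 / ρ) (by positivity)
      (by rw [div_lt_one hρ0]; linarith) (hm ▸ hx₁ hmem)
    rw [norm_sub_rev, ← hρ] at h1
    have h2 : m * ρ + σ / 2 * (ρ - 1) * ρ ≤ (ρ - 1) * c + s := by
      have := mul_le_mul_of_nonneg_right h1 hρ0.le
      have e1 : (m + σ / 2 * (1 - 1 / ρ) * (1 / ρ) * ρ ^ 2) * ρ =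
        m * ρ + σ / 2 * (ρ - 1) * ρ := by field_simp
      have e2 : ((1 - 1 / ρ) * c + 1 / ρ * s) * ρ = (ρ - 1) * c + s := by field_simp
      rw [e1, e2] at this; exact this
    have h3 : c - m ≤ σ / 2 * (ρ - 1) := by
      have : 2 * (c - m) / σ ≤ ρ - 2 := by linarith
      rw [div_le_iff₀ hσ] at this
      nlinarith
    nlinarith [mul_le_mul_of_nonneg_right h3 hρ0.le]

/-- If `u` is a subgradient of `f` at `x` then `f*(u) = ⟨u, x⟩ - f(x)`. -/
theorem convexConj_eq_coe {φ : E → EReal} {x u : E} {r : ℝ} (hx : φ x = r)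
    (h : ∀ v, ((r + ⟪u, v - x⟫_ℝ : ℝ) : EReal) ≤ φ v) :
    convexConj φ u = ((⟪u, x⟫_ℝ - r : ℝ) : EReal) := by
  apply le_antisymm
  · refine iSup_le fun v => ?_
    induction hv : φ v with
    | bot => have := h v; rw [hv] at this; simp at this
    | top => simp
    | coe s =>
      have := h v
      rw [hv, EReal.coe_le_coe_iff, inner_sub_right] at this
      rw [← EReal.coe_sub, EReal.coe_le_coe_iff]
      linarith
  · refine le_iSup_of_le x ?_
    rw [hx, EReal.coe_sub]

/-- The Fenchel–Young inequality. -/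
theorem le_convexConj {φ : E → EReal} {x : E} {r : ℝ} (hx : φ x = r) (u : E) :
    ((⟪u, x⟫_ℝ - r : ℝ) : EReal) ≤ convexConj φ u := by
  refine le_iSup_of_le x ?_
  rw [hx, EReal.coe_sub]

end Convexity

/-! ### Proximal subgradients and the inner maximizer x(y) -/

section Duality

variable {E V : Type*} [NormedAddCommGroup E] [InnerProductSpace ℝ E] [ProperSpace E]
  [NormedAddCommGroup V] [InnerProductSpace ℝ V]

/-- `z` minimizes g + (c/2)‖· - b‖². The growth modulus `c` around `z` equals the curvature of the
added quadratic, so the ‖v - z‖² terms cancel and an exact subgradient inequality remains, without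
any subdifferential sum rule. -/
theorem exists_subgradient_add_sq [ProperSpace V] {g : V → EReal} (hp : IsProperFun g)
    (hc : LowerSemicontinuous g) (hg : IsConvexFun g) {c : ℝ} (hcpos : 0 < c) (b : V) :
    ∃ (z : V) (s : ℝ), g z = s ∧ ∀ v, ((s + ⟪-(c • (z - b)), v - z⟫_ℝ : ℝ) : EReal) ≤ g v := by
  have hs : IsStronglyConvexFun (0 + c) (fun z => g z + ((c / 2 * ‖z - b‖ ^ 2 : ℝ) : EReal)) := by
    refine hg.isStronglyConvexFun_zero.add_coe fun x y α β hα hβ hαβ => le_of_eq ?_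
    have e1 : α • x + β • y - b = α • (x - b) + β • (y - b) := by
      have : b = (α + β) • b := by rw [hαβ, one_smul]
      nth_rewrite 1 [this]; module
    have e2 : x - y = (x - b) - (y - b) := by abel
    rw [e1, e2, norm_sub_sq_real, norm_add_sq_real, norm_smul, norm_smul, inner_smul_left,
      inner_smul_right, mul_pow, mul_pow, Real.norm_eq_abs, Real.norm_eq_abs, sq_abs, sq_abs]
    obtain rfl : β = 1 - α := by linarith
    simp only [conj_trivial]
    ring
  rw [zero_add] at hs
  obtain ⟨z, r, hz, hmin⟩ := hs.exists_min hcpos (hp.add_coe _)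
    (lowerSemicontinuous_add_coe hc (by fun_prop))
  have hgrow := hs.quadratic_growth hcpos hz hmin
  have hgz : g z = ((r - c / 2 * ‖z - b‖ ^ 2 : ℝ) : EReal) := by
    have hb := hp.1 z
    induction h : g z with
    | bot => exact absurd h hb
    | top => rw [h, EReal.top_add_coe] at hz; exact absurd hz (EReal.top_ne_coe _)
    | coe s =>
      rw [h, ← EReal.coe_add, EReal.coe_eq_coe_iff] at hz
      rw [EReal.coe_eq_coe_iff]; linarith
  refine ⟨z, _, hgz, fun v => ?_⟩
  have h := hgrow v
  induction hv : g v with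
  | bot => exact absurd hv (hp.1 v)
  | top => exact le_top
  | coe s =>
    rw [hv, ← EReal.coe_add, EReal.coe_le_coe_iff] at h
    rw [EReal.coe_le_coe_iff]
    have e : v - b = (v - z) + (z - b) := by abel
    rw [e, norm_add_sq_real] at h
    rw [inner_neg_left, inner_smul_left, real_inner_comm]
    simp only [conj_trivial]
    nlinarith

variable {f : E → EReal} {A : E →L[ℝ] V} {σ : ℝ} [ProperSpace V]

/-- f - ⟨Aᵀy, ·⟩ is still σ-strongly convex, hence has a minimizer. This validates the choice made
by `argmaxOf` and gives quadratic growth around it. -/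
theorem primalX_spec (hσ : 0 < σ) (hp : IsProperFun f) (hc : LowerSemicontinuous f)
    (hf : IsStronglyConvexFun σ f) (A : E →L[ℝ] V) (y : V) :
    ∃ r : ℝ, f (primalX f A y) = r ∧
      ∀ x, ((r + ⟪ContinuousLinearMap.adjoint A y, x - primalX f A y⟫_ℝ
        + σ / 2 * ‖x - primalX f A y‖ ^ 2 : ℝ) : EReal) ≤ f x := by
  set u := ContinuousLinearMap.adjoint A y with hu
  have hs : IsStronglyConvexFun (σ + 0) (fun x => f x + ((-⟪u, x⟫_ℝ : ℝ) : EReal)) := by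
    refine hf.add_coe fun x y α β hα hβ hαβ => le_of_eq ?_
    rw [inner_add_right, inner_smul_right, inner_smul_right]; ring
  rw [add_zero] at hs
  obtain ⟨x₀, r₀, hx₀, hmin⟩ := hs.exists_min hσ (hp.add_coe _)
    (lowerSemicontinuous_add_coe hc (by fun_prop))
  have hneg : ∀ x, ((⟪u, x⟫_ℝ : ℝ) : EReal) - f x = -(f x + ((-⟪u, x⟫_ℝ : ℝ) : EReal)) := by
    intro x
    rw [EReal.neg_add (Or.inr (EReal.coe_ne_top _)) (Or.inr (EReal.coe_ne_bot _))]
    simp only [EReal.coe_neg, sub_eq_add_neg, neg_neg]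
    rw [add_comm]
  have hex : ∃ x, IsMaxOn (fun x => ((⟪u, x⟫_ℝ : ℝ) : EReal) - f x) Set.univ x := by
    refine ⟨x₀, isMaxOn_univ_iff.2 fun x => ?_⟩
    simp only [hneg, EReal.neg_le_neg_iff]
    exact hmin x
  have hX : IsMaxOn (fun x => ((⟪u, x⟫_ℝ : ℝ) : EReal) - f x) Set.univ (primalX f A y) :=
    Classical.epsilon_spec hex
  set X := primalX f A y
  have hXmin : ∀ v, f X + ((-⟪u, X⟫_ℝ : ℝ) : EReal) ≤ f v + ((-⟪u, v⟫_ℝ : ℝ) : EReal) := by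
    intro v
    simpa only [hneg, EReal.neg_le_neg_iff] using isMaxOn_univ_iff.1 hX v
  have hfX : ∃ r : ℝ, f X = r := by
    induction h : f X with
    | bot => exact absurd h (hp.1 X)
    | top => have := hXmin x₀; rw [hx₀, h] at this; simp at this
    | coe s => exact ⟨s, rfl⟩
  obtain ⟨r, hr⟩ := hfX
  refine ⟨r, hr, fun x => ?_⟩
  have h := hs.quadratic_growth hσ (x := X) (r := r + -⟪u, X⟫_ℝ) (by rw [hr, EReal.coe_add])
    hXmin x
  induction hv : f x with
  | bot => exact absurd hv (hp.1 x)
  | top => exact le_top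
  | coe s =>
    rw [hv, ← EReal.coe_add, EReal.coe_le_coe_iff] at h
    rw [EReal.coe_le_coe_iff, inner_sub_right]
    linarith

end Duality

/-! ### The smooth dual part, the proximal step and duality gaps -/

section Duality

variable {E V : Type*} [NormedAddCommGroup E] [InnerProductSpace ℝ E] [ProperSpace E]
  [NormedAddCommGroup V] [InnerProductSpace ℝ V] [ProperSpace V]
  {f : E → EReal} {g : V → EReal} {A : E →L[ℝ] V} {σ L : ℝ}

theorem primalX_subgradient (hσ : 0 < σ) (hp : IsProperFun f) (hc : LowerSemicontinuous f)
    (hf : IsStronglyConvexFun σ f) (A : E →L[ℝ] V) (y : V) :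
    ∃ r : ℝ, f (primalX f A y) = r ∧
      (∀ x, ((r + ⟪ContinuousLinearMap.adjoint A y, x - primalX f A y⟫_ℝ : ℝ) : EReal) ≤ f x) ∧
      dualF f A y = ((⟪ContinuousLinearMap.adjoint A y, primalX f A y⟫_ℝ - r : ℝ) : EReal) := by
  obtain ⟨r, hr, h⟩ := primalX_spec hσ hp hc hf A y
  have h' : ∀ x, ((r + ⟪ContinuousLinearMap.adjoint A y, x - primalX f A y⟫_ℝ : ℝ) : EReal)
      ≤ f x := by
    refine fun x => le_trans (EReal.coe_le_coe_iff.2 ?_) (h x)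
    have : 0 ≤ σ / 2 * ‖x - primalX f A y‖ ^ 2 := by positivity
    linarith
  exact ⟨r, hr, h', convexConj_eq_coe hr h'⟩

theorem coe_toReal_dualF (hσ : 0 < σ) (hp : IsProperFun f) (hc : LowerSemicontinuous f)
    (hf : IsStronglyConvexFun σ f) (A : E →L[ℝ] V) (y : V) :
    ((dualF f A y).toReal : EReal) = dualF f A y := by
  obtain ⟨r, -, -, h⟩ := primalX_subgradient hσ hp hc hf A y
  rw [h, EReal.toReal_coe]

/-- Adding the two growth inequalities at x(v) and x(w) gives strong monotonicity; Cauchy–Schwarz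
finishes. With `gradF_eq` this says that ∇F is L_F-Lipschitz. -/
theorem norm_map_primalX_sub_le (hσ : 0 < σ) (hp : IsProperFun f) (hc : LowerSemicontinuous f)
    (hf : IsStronglyConvexFun σ f) (A : E →L[ℝ] V) (v w : V) :
    ‖A (primalX f A v) - A (primalX f A w)‖ ≤ ‖A‖ ^ 2 / σ * ‖v - w‖ := by
  obtain ⟨r, hr, h1⟩ := primalX_spec hσ hp hc hf A v
  obtain ⟨s, hs, h2⟩ := primalX_spec hσ hp hc hf A w
  have h1 := h1 (primalX f A w)
  have h2 := h2 (primalX f A v)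
  rw [hs, EReal.coe_le_coe_iff] at h1
  rw [hr, EReal.coe_le_coe_iff] at h2
  set x := primalX f A v
  set x' := primalX f A w
  have h3 : σ * ‖x - x'‖ ^ 2 ≤ ⟪ContinuousLinearMap.adjoint A (v - w), x - x'⟫_ℝ := by
    rw [norm_sub_rev x' x] at h1
    have e : ⟪ContinuousLinearMap.adjoint A v, x' - x⟫_ℝ =
      -⟪ContinuousLinearMap.adjoint A v, x - x'⟫_ℝ := by rw [← inner_neg_right, neg_sub]
    rw [map_sub, inner_sub_left]
    linarith
  have h4 : ⟪ContinuousLinearMap.adjoint A (v - w), x - x'⟫_ℝ ≤ ‖A‖ * ‖v - w‖ * ‖x - x'‖ := by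
    refine (real_inner_le_norm _ _).trans ?_
    gcongr
    refine (ContinuousLinearMap.le_opNorm _ _).trans_eq ?_
    rw [LinearIsometryEquiv.norm_map]
  have h5 : ‖x - x'‖ ≤ ‖A‖ * ‖v - w‖ / σ := by
    rw [le_div_iff₀ hσ]
    rcases (norm_nonneg (x - x')).eq_or_lt with h0 | h0
    · rw [← h0, zero_mul]; positivity
    · nlinarith
  rw [← map_sub]
  calc ‖A (x - x')‖ ≤ ‖A‖ * ‖x - x'‖ := A.le_opNorm _
    _ ≤ ‖A‖ * (‖A‖ * ‖v - w‖ / σ) := by gcongr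
    _ = _ := by ring

theorem dualF_toReal_ge (hσ : 0 < σ) (hp : IsProperFun f) (hc : LowerSemicontinuous f)
    (hf : IsStronglyConvexFun σ f) (A : E →L[ℝ] V) (v w : V) :
    (dualF f A w).toReal + ⟪v - w, A (primalX f A w)⟫_ℝ ≤ (dualF f A v).toReal := by
  obtain ⟨s, hs, -, h2⟩ := primalX_subgradient hσ hp hc hf A w
  have h3 := le_convexConj hs (ContinuousLinearMap.adjoint A v)
  rw [← dualF, ← coe_toReal_dualF hσ hp hc hf A v, EReal.coe_le_coe_iff] at h3
  rw [h2, EReal.toReal_coe]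
  rw [ContinuousLinearMap.adjoint_inner_left] at h3 ⊢
  rw [inner_sub_left]
  linarith

/-- A x(w) is a subgradient of F at w. Using the subgradients at both v and w, the linearization
error lies between 0 and ⟨v - w, Ax(v) - Ax(w)⟩ ≤ L_F‖v - w‖². -/
theorem gradF_eq (hσ : 0 < σ) (hp : IsProperFun f) (hc : LowerSemicontinuous f)
    (hf : IsStronglyConvexFun σ f) (A : E →L[ℝ] V) (w : V) :
    gradF f A w = A (primalX f A w) := by
  apply HasGradientAt.gradient
  rw [hasGradientAt_iff_hasFDerivAt]
  set Φ : V →L[ℝ] ℝ := InnerProductSpace.toDual ℝ V (A (primalX f A w)) with hΦ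
  have hbig : (fun v => (dualF f A v).toReal - (dualF f A w).toReal - Φ (v - w))
      =O[nhds w] fun v => ‖v - w‖ ^ 2 := by
    refine Asymptotics.IsBigO.of_bound (‖A‖ ^ 2 / σ) (Filter.Eventually.of_forall fun v => ?_)
    have h1 := dualF_toReal_ge hσ hp hc hf A v w
    have h2 := dualF_toReal_ge hσ hp hc hf A w v
    have h3 : ⟪v - w, A (primalX f A v) - A (primalX f A w)⟫_ℝ ≤
        ‖A‖ ^ 2 / σ * ‖v - w‖ ^ 2 := by
      refine (real_inner_le_norm _ _).trans ?_
      have := mul_le_mul_of_nonneg_left (norm_map_primalX_sub_le hσ hp hc hf A v w)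
        (norm_nonneg (v - w))
      linarith
    have e : Φ (v - w) = ⟪v - w, A (primalX f A w)⟫_ℝ := by
      rw [hΦ, InnerProductSpace.toDual_apply_apply, real_inner_comm]
    rw [← neg_sub v w, inner_neg_left] at h2
    rw [inner_sub_right] at h3
    rw [e, Real.norm_of_nonneg (by linarith), Real.norm_of_nonneg (by positivity)]
    linarith
  have h := (hbig.hasFDerivAt (by norm_num)).add
    ((Φ.hasFDerivAt.sub_const (Φ w)).const_add (dualF f A w).toReal)
  refine (h.congr_fderiv ?_).congr_of_eventuallyEq (Filter.Eventually.of_forall fun v => ?_)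
  · ext; simp
  · simp

omit [ProperSpace V] in
theorem dualG_ne_bot (hp : IsProperFun g) (y : V) : dualG g y ≠ ⊥ := by
  obtain ⟨hb, z, hz⟩ := hp
  intro h
  have := le_convexConj (EReal.coe_toReal hz (hb z)).symm (-y)
  rw [← dualG, h] at this
  exact EReal.coe_ne_bot _ (le_bot_iff.1 this)

/-- `p` and `z` satisfy the optimality conditions of the proximal step. -/
theorem proxGrad_spec (hσ : 0 < σ) (hp : IsProperFun f) (hc : LowerSemicontinuous f)
    (hf : IsStronglyConvexFun σ f) (hgp : IsProperFun g) (hgc : LowerSemicontinuous g)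
    (hg : IsConvexFun g) (A : E →L[ℝ] V) (hL : 0 < L) (w : V) :
    ∃ s : ℝ, g (proxZ f g A L w) = s ∧
      ∀ v, ((s + ⟪-proxGrad f g A L w, v - proxZ f g A L w⟫_ℝ : ℝ) : EReal) ≤ g v := by
  set b := A (primalX f A w) - L • w with hb
  -- The dual prox is solved on the primal side: with c = 1/L the subgradient of g at `z` is exactly
  -- -p for the `p` set next.
  obtain ⟨z, s, hz, hsub⟩ := exists_subgradient_add_sq hgp hgc hg (inv_pos.2 hL) b
  set p := L⁻¹ • (z - b) with hpdef
  have hzp : z = A (primalX f A w) + L • (p - w) := by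
    rw [hpdef, smul_sub, smul_inv_smul₀ hL.ne', hb]; abel
  have hGp : dualG g p = ((⟪-p, z⟫_ℝ - s : ℝ) : EReal) := convexConj_eq_coe hz hsub
  -- Growth of the model around `p` gives existence and uniqueness of its minimizer, so the point
  -- chosen by `proxGrad` must be `p`.
  have hQ : ∀ y, quadModel f g A L p w + ((L / 2 * ‖y - p‖ ^ 2 : ℝ) : EReal)
      ≤ quadModel f g A L y w := by
    intro y
    have hy := le_convexConj hz (-y)
    rw [← dualG] at hy
    unfold quadModel
    rw [← coe_toReal_dualF hσ hp hc hf A w, gradF_eq hσ hp hc hf, hGp]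
    refine le_trans ?_ (add_le_add_right hy _)
    norm_cast
    have e1 : y - w = (y - p) + (p - w) := by abel
    have e2 : ⟪y - p, z⟫_ℝ = ⟪y - p, A (primalX f A w)⟫_ℝ + L * ⟪y - p, p - w⟫_ℝ := by
      rw [hzp, inner_add_right, inner_smul_right]
    rw [e1, norm_add_sq_real, inner_add_left, inner_neg_left, inner_neg_left]
    rw [inner_sub_left] at e2
    nlinarith
  have hfin : ∃ c : ℝ, quadModel f g A L p w = c := by
    unfold quadModel
    rw [← coe_toReal_dualF hσ hp hc hf A w, hGp]
    exact ⟨_, by norm_cast⟩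
  obtain ⟨c, hcQ⟩ := hfin
  have hmin : IsMinOn (fun y => quadModel f g A L y w) Set.univ (proxGrad f g A L w) := by
    refine Classical.epsilon_spec (p := fun p => IsMinOn (fun y => quadModel f g A L y w)
      Set.univ p) ⟨p, isMinOn_univ_iff.2 fun y => le_trans ?_ (hQ y)⟩
    rw [hcQ]
    norm_cast
    have : 0 ≤ L / 2 * ‖y - p‖ ^ 2 := by positivity
    linarith
  have heq : proxGrad f g A L w = p := by
    have h := (hQ (proxGrad f g A L w)).trans (isMinOn_univ_iff.1 hmin p)
    simp only [hcQ] at h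
    norm_cast at h
    have h0 : ‖proxGrad f g A L w - p‖ ^ 2 ≤ 0 := by
      by_contra! h1
      nlinarith [mul_pos hL h1]
    exact sub_eq_zero.1 (norm_eq_zero.1 (pow_eq_zero_iff two_ne_zero |>.1
      (le_antisymm h0 (by positivity))))
  rw [proxZ, heq, ← hzp]
  exact ⟨s, hz, hsub⟩

/-- The real-valued dual objective. -/
noncomputable def dualObjReal (f : E → EReal) (g : V → EReal) (A : E →L[ℝ] V) (y : V) : ℝ :=
  (dualF f A y).toReal + (dualG g y).toReal

/-- `dualObjReal` is meaningful only where G is finite, since `toReal` sends ⊤ to 0; this admits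
proximal points as comparison points in the descent inequality. -/
theorem dualG_proxGrad_ne_top (hσ : 0 < σ) (hp : IsProperFun f) (hc : LowerSemicontinuous f)
    (hf : IsStronglyConvexFun σ f) (hgp : IsProperFun g) (hgc : LowerSemicontinuous g)
    (hg : IsConvexFun g) (A : E →L[ℝ] V) (hL : 0 < L) (w : V) :
    dualG g (proxGrad f g A L w) ≠ ⊤ := by
  obtain ⟨s, hs, h⟩ := proxGrad_spec hσ hp hc hf hgp hgc hg A hL w
  rw [dualG, convexConj_eq_coe hs h]
  exact EReal.coe_ne_top _

/-- The descent inequality of the proximal gradient step under backtracking. -/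
theorem BacktrackCond.descent (hσ : 0 < σ) (hp : IsProperFun f) (hc : LowerSemicontinuous f)
    (hf : IsStronglyConvexFun σ f) (hgp : IsProperFun g) (hgc : LowerSemicontinuous g)
    (hg : IsConvexFun g) (hL : 0 < L) {w : V} (hb : BacktrackCond f g A L w)
    {y : V} (hy : dualG g y ≠ ⊤) :
    L / 2 * (‖y - proxGrad f g A L w‖ ^ 2 - ‖y - w‖ ^ 2) ≤
      dualObjReal f g A y - dualObjReal f g A (proxGrad f g A L w) := by
  obtain ⟨s, hs, h⟩ := proxGrad_spec hσ hp hc hf hgp hgc hg A hL w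
  have hz : proxZ f g A L w = A (primalX f A w) + L • (proxGrad f g A L w - w) := rfl
  unfold BacktrackCond dualObj quadModel at hb
  rw [dualObjReal, dualObjReal]
  set p := proxGrad f g A L w
  set z := proxZ f g A L w
  have hGp : dualG g p = ((⟪-p, z⟫_ℝ - s : ℝ) : EReal) := convexConj_eq_coe hs h
  have hGy := le_convexConj hs (-y)
  rw [← dualG, ← EReal.coe_toReal hy (dualG_ne_bot hgp y), EReal.coe_le_coe_iff] at hGy
  rw [← coe_toReal_dualF hσ hp hc hf A w, ← coe_toReal_dualF hσ hp hc hf A p,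
    gradF_eq hσ hp hc hf, hGp] at hb
  norm_cast at hb
  have hF := dualF_toReal_ge hσ hp hc hf A y w
  rw [hGp, EReal.toReal_coe]
  have e1 : y - w = (y - p) + (p - w) := by abel
  have e2 : ⟪y - p, z⟫_ℝ = ⟪y - p, A (primalX f A w)⟫_ℝ + L * ⟪y - p, p - w⟫_ℝ := by
    rw [hz, inner_add_right, inner_smul_right]
  rw [e1, inner_add_left] at hF
  rw [e1, norm_add_sq_real]
  rw [inner_neg_left] at hGy hb ⊢
  rw [inner_sub_left] at e2
  nlinarith

/-- The dual value at a proximal point is attained at `(x(p), z(p))`. -/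
theorem dualFun_proxGrad (hσ : 0 < σ) (hp : IsProperFun f) (hc : LowerSemicontinuous f)
    (hf : IsStronglyConvexFun σ f) {p z : V} {s : ℝ} (hs : g z = s)
    (h : ∀ v, ((s + ⟪-p, v - z⟫_ℝ : ℝ) : EReal) ≤ g v) :
    dualFun f g A p = ((-dualObjReal f g A p : ℝ) : EReal) := by
  obtain ⟨r, hr, hsub, hF⟩ := primalX_subgradient hσ hp hc hf A p
  have hG : dualG g p = ((⟪-p, z⟫_ℝ - s : ℝ) : EReal) := convexConj_eq_coe hs h
  rw [dualObjReal, hF, hG, EReal.toReal_coe, EReal.toReal_coe]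
  unfold dualFun splitObj
  apply le_antisymm
  · refine iInf₂_le_of_le (primalX f A p) z ?_
    rw [hr, hs]
    norm_cast
    rw [ContinuousLinearMap.adjoint_inner_left, inner_neg_left, inner_sub_right]
    linarith
  · refine le_iInf₂ fun x v => ?_
    refine le_trans ?_ (EReal.sub_le_sub (add_le_add (hsub x) (h v)) le_rfl)
    norm_cast
    rw [ContinuousLinearMap.adjoint_inner_left, ContinuousLinearMap.adjoint_inner_left,
      inner_neg_left, inner_neg_left, map_sub]
    simp only [inner_sub_right]
    linarith

/-- A maximizer of the dual function minimizes the dual objective, which is finite there. -/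
theorem dualObjReal_le_of_isMaxOn (hσ : 0 < σ) (hp : IsProperFun f) (hc : LowerSemicontinuous f)
    (hf : IsStronglyConvexFun σ f) (hgp : IsProperFun g) {p z yStar : V} {s : ℝ} (hs : g z = s)
    (h : ∀ v, ((s + ⟪-p, v - z⟫_ℝ : ℝ) : EReal) ≤ g v)
    (hy : IsMaxOn (dualFun f g A) Set.univ yStar) :
    dualG g yStar ≠ ⊤ ∧ dualObjReal f g A yStar ≤ dualObjReal f g A p := by
  have h1 := isMaxOn_univ_iff.1 hy p
  rw [dualFun_proxGrad hσ hp hc hf hs h] at h1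
  obtain ⟨r, hr, hsub, hF⟩ := primalX_subgradient hσ hp hc hf A yStar
  have h2 : dualG g yStar ≤
      ((dualObjReal f g A p - (dualF f A yStar).toReal : ℝ) : EReal) := by
    refine iSup_le fun v => ?_
    -- Freezing x = x(y_*) in the infimum defining q(y_*) ≥ q(p) bounds every term of the supremum
    -- g*(-y_*).
    have h3 : ((-dualObjReal f g A p : ℝ) : EReal) ≤
        f (primalX f A yStar) + g v - ((⟪yStar, A (primalX f A yStar) - v⟫_ℝ : ℝ) : EReal) :=
      h1.trans (iInf₂_le _ _)
    induction hv : g v with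
    | bot => exact absurd hv (hgp.1 v)
    | top => simp
    | coe c =>
      rw [hr, hv] at h3
      norm_cast at h3
      norm_cast
      rw [hF, EReal.toReal_coe, ContinuousLinearMap.adjoint_inner_left, inner_neg_left]
      rw [inner_sub_right] at h3
      linarith
  have h3 : dualG g yStar ≠ ⊤ := ne_top_of_le_ne_top (EReal.coe_ne_top _) h2
  refine ⟨h3, ?_⟩
  rw [← EReal.coe_toReal h3 (dualG_ne_bot hgp yStar), EReal.coe_le_coe_iff] at h2
  rw [dualObjReal]
  linarith

omit [ProperSpace V] in
theorem isPrimalZ_of_subgradient {p z : V} {s : ℝ} (hgp : IsProperFun g) (hs : g z = s)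
    (h : ∀ v, ((s + ⟪-p, v - z⟫_ℝ : ℝ) : EReal) ≤ g v) : IsPrimalZ g p z := by
  refine isMinOn_univ_iff.2 fun v => ?_
  have := h v
  rw [hs]
  induction hv : g v with
  | bot => exact absurd hv (hgp.1 v)
  | top => simp
  | coe c =>
    rw [hv, EReal.coe_le_coe_iff, inner_neg_left, inner_sub_right] at this
    norm_cast
    linarith

/-- The infeasibility `A x(p) - z(p)` at a proximal point. -/
theorem norm_map_primalX_sub_proxZ_le (hσ : 0 < σ) (hp : IsProperFun f)
    (hc : LowerSemicontinuous f) (hf : IsStronglyConvexFun σ f) (A : E →L[ℝ] V) (hL : 0 < L)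
    (w : V) :
    ‖A (primalX f A (proxGrad f g A L w)) - proxZ f g A L w‖ ≤
      (L + ‖A‖ ^ 2 / σ) * ‖proxGrad f g A L w - w‖ := by
  have h := norm_map_primalX_sub_le hσ hp hc hf A (proxGrad f g A L w) w
  rw [proxZ, ← sub_sub]
  refine (norm_sub_le _ _).trans ?_
  rw [norm_smul, Real.norm_of_nonneg hL.le]
  linarith

/-- The duality gap of the split problem at a proximal point. -/
theorem splitObj_sub_dualFun_le (hσ : 0 < σ) (hp : IsProperFun f) (hc : LowerSemicontinuous f)
    (hf : IsStronglyConvexFun σ f) {p z : V} {s : ℝ} (hs : g z = s)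
    (h : ∀ v, ((s + ⟪-p, v - z⟫_ℝ : ℝ) : EReal) ≤ g v) :
    splitObj f g (primalX f A p) z - dualFun f g A p ≤
      ((‖p‖ * ‖A (primalX f A p) - z‖ : ℝ) : EReal) := by
  obtain ⟨r, hr, hsub, hF⟩ := primalX_subgradient hσ hp hc hf A p
  have hG : dualG g p = ((⟪-p, z⟫_ℝ - s : ℝ) : EReal) := convexConj_eq_coe hs h
  rw [dualFun_proxGrad hσ hp hc hf hs h, dualObjReal, hF, hG, EReal.toReal_coe, EReal.toReal_coe,
    splitObj, hr, hs]
  norm_cast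
  refine le_trans (le_of_eq ?_) (real_inner_le_norm _ _)
  rw [ContinuousLinearMap.adjoint_inner_left, inner_neg_left, inner_sub_right]
  ring

/-- The duality gap of the original problem at a proximal point. -/
theorem primalObj_sub_dualFun_le (hσ : 0 < σ) (hp : IsProperFun f) (hc : LowerSemicontinuous f)
    (hf : IsStronglyConvexFun σ f) (hgp : IsProperFun g) {p z : V} {s : ℝ} (hs : g z = s)
    (h : ∀ v, ((s + ⟪-p, v - z⟫_ℝ : ℝ) : EReal) ≤ g v) (hbd : HasBoundedSubgradients g) :
    primalObj f g A (primalX f A p) - dualFun f g A p ≤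
      (((‖p‖ + subgradBound g) * ‖A (primalX f A p) - z‖ : ℝ) : EReal) := by
  have hgap := splitObj_sub_dualFun_le (A := A) hσ hp hc hf hs h
  obtain ⟨r, hr, -, -⟩ := primalX_subgradient hσ hp hc hf A p
  obtain ⟨d, hd⟩ := hbd.1 (A (primalX f A p))
  -- The subgradient is taken at Ax(p) and tested at `z`, which bounds g(Ax(p)) - g(z) from above.
  have hdz := hd z
  have hdn : ‖d‖ ≤ subgradBound g := le_csSup hbd.2 ⟨_, d, hd, rfl⟩
  rw [dualFun_proxGrad hσ hp hc hf hs h, splitObj, hr, hs] at hgap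
  rw [dualFun_proxGrad hσ hp hc hf hs h, primalObj, hr]
  rw [hs] at hdz
  set v := A (primalX f A p)
  have hin : ⟪d, v - z⟫_ℝ ≤ subgradBound g * ‖v - z‖ :=
    (real_inner_le_norm _ _).trans (by gcongr)
  induction hv : g v with
  | bot => exact absurd hv (hgp.1 v)
  | top => rw [hv, EReal.top_add_coe] at hdz; exact absurd (top_le_iff.1 hdz) (EReal.coe_ne_top _)
  | coe c =>
    rw [hv] at hdz
    norm_cast at hdz hgap ⊢
    rw [← neg_sub v z, inner_neg_right] at hdz
    linarith

end Duality

/-! ### Potential analysis of the accelerated iteration -/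

section Acceleration

variable {V : Type*} [NormedAddCommGroup V] [InnerProductSpace ℝ V]

/-- One step of the potential argument for accelerated proximal gradient methods. -/
theorem accelerated_step {y y' w u ys : V} {S t L v v' vs : ℝ} (hL : 0 < L) (ht : 0 < t)
    (hw : (S + t) • w = S • y + t • u)
    (h1 : L / 2 * (‖ys - y'‖ ^ 2 - ‖ys - w‖ ^ 2) ≤ vs - v')
    (h2 : S * (L / 2 * (‖y - y'‖ ^ 2 - ‖y - w‖ ^ 2)) ≤ S * (v - v')) :
    (S + t - t ^ 2) * ‖y' - w‖ ^ 2 + ‖u + t • (y' - w) - ys‖ ^ 2 + 2 * (S + t) * (v' - vs) / L ≤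
      ‖u - ys‖ ^ 2 + 2 * S * (v - vs) / L := by
  set d := y' - w with hd
  have e : ∀ x : V, ‖x - y'‖ ^ 2 - ‖x - w‖ ^ 2 = ‖d‖ ^ 2 + 2 * (⟪d, w⟫_ℝ - ⟪d, x⟫_ℝ) := by
    intro x
    have : x - y' = (x - w) - d := by rw [hd]; abel
    rw [this, norm_sub_sq_real, real_inner_comm, inner_sub_right]; ring
  have e3 : ‖u + t • d - ys‖ ^ 2 = ‖u - ys‖ ^ 2 + 2 * t * (⟪d, u⟫_ℝ - ⟪d, ys⟫_ℝ)
      + t ^ 2 * ‖d‖ ^ 2 := by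
    have : u + t • d - ys = (u - ys) + t • d := by abel
    rw [this, norm_add_sq_real, inner_smul_right, real_inner_comm, inner_sub_right, norm_smul,
      mul_pow, Real.norm_eq_abs, sq_abs]
    ring
  have e4 : (S + t) * ⟪d, w⟫_ℝ = S * ⟪d, y⟫_ℝ + t * ⟪d, u⟫_ℝ := by
    have := congrArg (fun x => ⟪d, x⟫_ℝ) hw
    simpa only [inner_add_right, inner_smul_right] using this
  rw [e] at h1 h2
  rw [e3]
  -- `t` times the descent inequality at `ys` plus `S` times the one at `y`; `e4` turns the inner
  -- products into those with `u`.
  have h3 : L / 2 * ((S + t) * ‖d‖ ^ 2 + 2 * t * (⟪d, u⟫_ℝ - ⟪d, ys⟫_ℝ)) ≤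
      S * (v - vs) - (S + t) * (v' - vs) := by
    have := mul_le_mul_of_nonneg_left h1 ht.le
    linear_combination this + h2 - L * e4
  have h4 : (S + t) * ‖d‖ ^ 2 + 2 * t * (⟪d, u⟫_ℝ - ⟪d, ys⟫_ℝ) ≤
      2 * S * (v - vs) / L - 2 * (S + t) * (v' - vs) / L := by
    rw [← sub_div, le_div_iff₀ hL]
    linarith
  linarith

variable {t L v : ℕ → ℝ} {y w : ℕ → V} {ys : V} {vs : ℝ}

theorem partialT_zero (t : ℕ → ℝ) : partialT t 0 = t 0 := by simp [partialT]

theorem partialT_succ (t : ℕ → ℝ) (k : ℕ) : partialT t (k + 1) = partialT t k + t (k + 1) :=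
  Finset.sum_range_succ _ _

theorem le_partialT (ht : ∀ k, 0 < t k) (k : ℕ) : t k ≤ partialT t k :=
  Finset.single_le_sum (f := t) (fun i _ => (ht i).le) (Finset.self_mem_range_succ k)

theorem partialT_pos (ht : ∀ k, 0 < t k) (k : ℕ) : 0 < partialT t k :=
  (ht k).trans_le (le_partialT ht k)

/-- The auxiliary sequence of the accelerated method. -/
noncomputable def auxSeq (t : ℕ → ℝ) (y w : ℕ → V) (k : ℕ) : V :=
  y 0 + ∑ i ∈ Finset.range k, t i • (y (i + 1) - w i)

theorem auxSeq_succ (t : ℕ → ℝ) (y w : ℕ → V) (k : ℕ) :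
    auxSeq t y w (k + 1) = auxSeq t y w k + t k • (y (k + 1) - w k) := by
  rw [auxSeq, Finset.sum_range_succ, ← add_assoc, auxSeq]

/-- The two-term extrapolation rule is designed for this identity: it exhibits `w k` as a weighted
mean of `y k` and the auxiliary point, as `accelerated_step` requires with S = T_k - t_k. -/
theorem partialT_smul_eq (ht : ∀ k, 0 < t k) (hw0 : w 0 = y 0)
    (hw : ∀ k, w (k + 1) = y (k + 1)
      + ((partialT t k - t k) * t (k + 1) / (t k * partialT t (k + 1))) • (y (k + 1) - y k)
      + ((t k ^ 2 - partialT t k) * t (k + 1) / (t k * partialT t (k + 1))) • (y (k + 1) - w k))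
    (k : ℕ) :
    partialT t k • w k = (partialT t k - t k) • y k + t k • auxSeq t y w k := by
  induction k with
  | zero => simp [partialT_zero, auxSeq, hw0]
  | succ k ih =>
    have h0 := (ht k).ne'
    have h1 := (partialT_pos ht (k + 1)).ne'
    have hu : auxSeq t y w k = (partialT t k / t k) • w k - (partialT t k / t k - 1) • y k := by
      have := congrArg (fun x => (t k)⁻¹ • x) ih
      simp only [smul_add, inv_smul_smul₀ h0] at this
      rw [← sub_eq_iff_eq_add'] at this
      rw [← this]
      match_scalars <;> field_simp
    rw [auxSeq_succ, hu, hw k]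
    have h2 : partialT t (k + 1) - t (k + 1) = partialT t k := by rw [partialT_succ]; ring
    rw [h2]
    have h3 : partialT t k = partialT t (k + 1) - t (k + 1) := h2.symm
    generalize partialT t (k + 1) = T' at *
    rw [h3]
    match_scalars <;> field_simp <;> ring

/-- `accelerated_step` telescopes; changing L_{k+1} to L_{k+2} only shrinks the value term, because
v ≥ vs. -/
theorem accelerated_potential (ht : ∀ k, 0 < t k) (hLpos : ∀ k, 0 < L k)
    (hL : ∀ k, L k ≤ L (k + 1)) (hw0 : w 0 = y 0)
    (hw : ∀ k, w (k + 1) = y (k + 1)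
      + ((partialT t k - t k) * t (k + 1) / (t k * partialT t (k + 1))) • (y (k + 1) - y k)
      + ((t k ^ 2 - partialT t k) * t (k + 1) / (t k * partialT t (k + 1))) • (y (k + 1) - w k))
    (h1 : ∀ k, L (k + 1) / 2 * (‖ys - y (k + 1)‖ ^ 2 - ‖ys - w k‖ ^ 2) ≤ vs - v (k + 1))
    (h2 : ∀ k, L (k + 2) / 2 * (‖y (k + 1) - y (k + 2)‖ ^ 2 - ‖y (k + 1) - w (k + 1)‖ ^ 2)
      ≤ v (k + 1) - v (k + 2))
    (hvs : ∀ k, vs ≤ v (k + 1)) (k : ℕ) :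
    ∑ i ∈ Finset.range (k + 1), (partialT t i - t i ^ 2) * ‖y (i + 1) - w i‖ ^ 2
      + ‖auxSeq t y w (k + 1) - ys‖ ^ 2 + 2 * partialT t k * (v (k + 1) - vs) / L (k + 1)
      ≤ ‖y 0 - ys‖ ^ 2 := by
  induction k with
  | zero =>
    -- The start is arbitrary and may have infinite dual value, so no descent inequality is
    -- available there; S = 0 makes the value `v := 0` irrelevant.
    have h := accelerated_step (S := 0) (y := y 0) (u := y 0) (v := 0) (hLpos 1) (ht 0)
      (by rw [hw0]; simp) (h1 0) (by simp)
    simpa [partialT_zero, auxSeq, add_assoc] using h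
  | succ k ih =>
    have hS : partialT t (k + 1) = partialT t k + t (k + 1) := partialT_succ t k
    have h := accelerated_step (S := partialT t k) (t := t (k + 1)) (hLpos (k + 2)) (ht (k + 1))
      (by
        have := partialT_smul_eq ht hw0 hw (k + 1)
        rwa [hS, add_sub_cancel_right] at this)
      (h1 (k + 1)) (mul_le_mul_of_nonneg_left (h2 k) (partialT_pos ht k).le)
    rw [← hS, ← auxSeq_succ] at h
    have h3 : 2 * partialT t k * (v (k + 1) - vs) / L (k + 2) ≤
        2 * partialT t k * (v (k + 1) - vs) / L (k + 1) := by
      have := partialT_pos ht k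
      have := sub_nonneg.2 (hvs k)
      exact div_le_div_of_nonneg_left (by positivity) (hLpos _) (hL _)
    rw [Finset.sum_range_succ]
    linarith

theorem norm_auxSeq_sub_le (ht : ∀ k, 0 < t k) (hsq : ∀ k, t k ^ 2 ≤ partialT t k)
    (hLpos : ∀ k, 0 < L k) (hL : ∀ k, L k ≤ L (k + 1)) (hw0 : w 0 = y 0)
    (hw : ∀ k, w (k + 1) = y (k + 1)
      + ((partialT t k - t k) * t (k + 1) / (t k * partialT t (k + 1))) • (y (k + 1) - y k)
      + ((t k ^ 2 - partialT t k) * t (k + 1) / (t k * partialT t (k + 1))) • (y (k + 1) - w k))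
    (h1 : ∀ k, L (k + 1) / 2 * (‖ys - y (k + 1)‖ ^ 2 - ‖ys - w k‖ ^ 2) ≤ vs - v (k + 1))
    (h2 : ∀ k, L (k + 2) / 2 * (‖y (k + 1) - y (k + 2)‖ ^ 2 - ‖y (k + 1) - w (k + 1)‖ ^ 2)
      ≤ v (k + 1) - v (k + 2))
    (hvs : ∀ k, vs ≤ v (k + 1)) (k : ℕ) :
    ‖auxSeq t y w k - ys‖ ≤ ‖y 0 - ys‖ := by
  cases k with
  | zero => simp [auxSeq]
  | succ k =>
    have h := accelerated_potential ht hLpos hL hw0 hw h1 h2 hvs k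
    have h3 : 0 ≤ ∑ i ∈ Finset.range (k + 1), (partialT t i - t i ^ 2) * ‖y (i + 1) - w i‖ ^ 2 :=
      Finset.sum_nonneg fun i _ => mul_nonneg (sub_nonneg.2 (hsq i)) (sq_nonneg _)
    have h4 : 0 ≤ 2 * partialT t k * (v (k + 1) - vs) / L (k + 1) := by
      have := partialT_pos ht k
      have := sub_nonneg.2 (hvs k)
      have := hLpos (k + 1)
      positivity
    exact (sq_le_sq₀ (norm_nonneg _) (norm_nonneg _)).1 (by linarith)

omit [InnerProductSpace ℝ V] in
-- The right side of `h` is nonpositive, so a proximal step never moves away from a minimizer.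
theorem norm_sub_le_of_prox_step {L v vs : ℝ} {y' w ys : V} (hL : 0 < L) (hvs : vs ≤ v)
    (h : L / 2 * (‖ys - y'‖ ^ 2 - ‖ys - w‖ ^ 2) ≤ vs - v) : ‖y' - ys‖ ≤ ‖w - ys‖ := by
  rw [norm_sub_rev y', norm_sub_rev w]
  refine abs_le_of_sq_le_sq' ?_ (norm_nonneg _) |>.2
  by_contra! h1
  nlinarith

/-- The iterates of the accelerated method are no farther from a minimizer than the starting
point. -/
theorem norm_iterate_sub_le (ht : ∀ k, 0 < t k) (hsq : ∀ k, t k ^ 2 ≤ partialT t k)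
    (hLpos : ∀ k, 0 < L k) (hL : ∀ k, L k ≤ L (k + 1)) (hw0 : w 0 = y 0)
    (hw : ∀ k, w (k + 1) = y (k + 1)
      + ((partialT t k - t k) * t (k + 1) / (t k * partialT t (k + 1))) • (y (k + 1) - y k)
      + ((t k ^ 2 - partialT t k) * t (k + 1) / (t k * partialT t (k + 1))) • (y (k + 1) - w k))
    (h1 : ∀ k, L (k + 1) / 2 * (‖ys - y (k + 1)‖ ^ 2 - ‖ys - w k‖ ^ 2) ≤ vs - v (k + 1))
    (h2 : ∀ k, L (k + 2) / 2 * (‖y (k + 1) - y (k + 2)‖ ^ 2 - ‖y (k + 1) - w (k + 1)‖ ^ 2)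
      ≤ v (k + 1) - v (k + 2))
    (hvs : ∀ k, vs ≤ v (k + 1)) (k : ℕ) :
    ‖y k - ys‖ ≤ ‖y 0 - ys‖ := by
  induction k with
  | zero => exact le_rfl
  | succ k ih =>
    refine (norm_sub_le_of_prox_step (hLpos (k + 1)) (hvs k) (h1 k)).trans ?_
    have hT := partialT_pos ht k
    have hu := norm_auxSeq_sub_le ht hsq hLpos hL hw0 hw h1 h2 hvs k
    have hle := sub_nonneg.2 (le_partialT ht k)
    -- Convex combination of two points in the ball of radius ‖y 0 - ys‖ about `ys`.
    have he : partialT t k • (w k - ys) =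
        (partialT t k - t k) • (y k - ys) + t k • (auxSeq t y w k - ys) := by
      rw [smul_sub, partialT_smul_eq ht hw0 hw k]; module
    have hn : partialT t k * ‖w k - ys‖ ≤ partialT t k * ‖y 0 - ys‖ := by
      calc partialT t k * ‖w k - ys‖ = ‖partialT t k • (w k - ys)‖ := by
            rw [norm_smul, Real.norm_of_nonneg hT.le]
        _ ≤ (partialT t k - t k) * ‖y k - ys‖ + t k * ‖auxSeq t y w k - ys‖ := by
            rw [he]
            refine (norm_add_le _ _).trans_eq ?_
            rw [norm_smul, norm_smul, Real.norm_of_nonneg hle, Real.norm_of_nonneg (ht k).le]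
        _ ≤ (partialT t k - t k) * ‖y 0 - ys‖ + t k * ‖y 0 - ys‖ := by
            have := (ht k).le
            gcongr
        _ = _ := by ring
    exact le_of_mul_le_mul_left hn hT

/-- A weighted sum of the squared step lengths, including one more proximal gradient step. -/
theorem accelerated_steps_sum_le (ht : ∀ k, 0 < t k)
    (hLpos : ∀ k, 0 < L k) (hL : ∀ k, L k ≤ L (k + 1)) (hw0 : w 0 = y 0)
    (hw : ∀ k, w (k + 1) = y (k + 1)
      + ((partialT t k - t k) * t (k + 1) / (t k * partialT t (k + 1))) • (y (k + 1) - y k)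
      + ((t k ^ 2 - partialT t k) * t (k + 1) / (t k * partialT t (k + 1))) • (y (k + 1) - w k))
    (h1 : ∀ k, L (k + 1) / 2 * (‖ys - y (k + 1)‖ ^ 2 - ‖ys - w k‖ ^ 2) ≤ vs - v (k + 1))
    (h2 : ∀ k, L (k + 2) / 2 * (‖y (k + 1) - y (k + 2)‖ ^ 2 - ‖y (k + 1) - w (k + 1)‖ ^ 2)
      ≤ v (k + 1) - v (k + 2))
    (hvs : ∀ k, vs ≤ v (k + 1)) {k : ℕ} {L' v' : ℝ} {p : V} (hL' : L (k + 1) ≤ L')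
    (hv' : vs ≤ v') (hp : L' / 2 * ‖y (k + 1) - p‖ ^ 2 ≤ v (k + 1) - v') :
    ∑ i ∈ Finset.range (k + 1), (partialT t i - t i ^ 2) * ‖y (i + 1) - w i‖ ^ 2
      + partialT t k * ‖p - y (k + 1)‖ ^ 2 ≤ ‖y 0 - ys‖ ^ 2 := by
  have h := accelerated_potential ht hLpos hL hw0 hw h1 h2 hvs k
  -- The extra step starts at `y (k + 1)` itself, so its length is controlled by the value term of
  -- the potential; L(k+1) ≤ L' makes the constants match.
  have h3 : ‖p - y (k + 1)‖ ^ 2 ≤ 2 * (v (k + 1) - vs) / L (k + 1) := by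
    rw [le_div_iff₀ (hLpos _), norm_sub_rev]
    nlinarith [sq_nonneg ‖y (k + 1) - p‖]
  have h4 := mul_le_mul_of_nonneg_left h3 (partialT_pos ht k).le
  have h5 : partialT t k * (2 * (v (k + 1) - vs) / L (k + 1)) =
    2 * partialT t k * (v (k + 1) - vs) / L (k + 1) := by ring
  have h6 := sq_nonneg ‖auxSeq t y w (k + 1) - ys‖
  linarith

end Acceleration

/-! ### Weights for t_k = (k + a)/a -/

section LinearSteps

theorem partialT_linear {a : ℝ} (ha : 0 < a) (k : ℕ) :
    partialT (fun k => ((k : ℝ) + a) / a) k = (k + 1) * (k + 2 * a) / (2 * a) := by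
  induction k with
  | zero => rw [partialT_zero]; field_simp; push_cast; ring
  | succ k ih => rw [partialT_succ, ih]; field_simp; push_cast; ring

theorem sum_partialT_sub_sq_linear {a : ℝ} (ha : 0 < a) (k : ℕ) :
    ∑ i ∈ Finset.range k, (partialT (fun k => ((k : ℝ) + a) / a) i - (((i : ℝ) + a) / a) ^ 2) =
      (a - 2) / (2 * a ^ 2) * ((2 * (k : ℝ) ^ 3 - 3 * k ^ 2 + k) / 6)
        + (2 * a - 3) / (2 * a) * (((k : ℝ) ^ 2 - k) / 2) := by
  induction k with
  | zero => simp
  | succ k ih =>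
    rw [Finset.sum_range_succ, ih, partialT_linear ha]; field_simp; push_cast; ring

/-- T_i - t_i² = ((a - 2)i² + a(2a - 3)i)/(2a²), whose sum has leading term (a - 2)/(6a²) times the
cube. Adding T_k makes all lower-order coefficients in k + 1 nonnegative (`key`). -/
theorem le_weights_linear {a : ℝ} (ha : 2 < a) (k : ℕ) :
    (a - 2) * ((k + 1 : ℕ) : ℝ) ^ 3 / (6 * a ^ 2) ≤
      ∑ i ∈ Finset.range (k + 1),
        (partialT (fun k => ((k : ℝ) + a) / a) i - (((i : ℝ) + a) / a) ^ 2)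
        + partialT (fun k => ((k : ℝ) + a) / a) k := by
  have ha0 : 0 < a := by linarith
  rw [sum_partialT_sub_sq_linear ha0, partialT_linear ha0, ← sub_nonneg]
  have hk : (0 : ℝ) ≤ k := k.cast_nonneg
  obtain ⟨b, hb, rfl⟩ : ∃ b, 0 < b ∧ a = b + 2 := ⟨a - 2, by linarith, by ring⟩
  have key : 0 ≤ ((2 * (b + 2) ^ 2 - 2 * (b + 2) + 2) * ((k : ℝ) + 1) ^ 2
      + (b / 3 + (2 * (b + 2) ^ 2 + (b + 2)) ) * ((k : ℝ) + 1)) / (4 * (b + 2) ^ 2) := by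
    apply div_nonneg _ (by positivity)
    have : 0 ≤ 2 * (b + 2) ^ 2 - 2 * (b + 2) + 2 := by nlinarith
    positivity
  refine key.trans_eq ?_
  push_cast
  field_simp
  ring

theorem linear_weights_nonneg {a : ℝ} (ha : 2 < a) (k : ℕ) :
    (((k : ℝ) + a) / a) ^ 2 ≤ partialT (fun k => ((k : ℝ) + a) / a) k := by
  have ha0 : 0 < a := by linarith
  have hk : (0 : ℝ) ≤ k := k.cast_nonneg
  rw [partialT_linear ha0, div_pow, div_le_div_iff₀ (by positivity) (by positivity)]
  obtain ⟨b, hb, rfl⟩ : ∃ b, 0 < b ∧ a = b + 2 := ⟨a - 2, by linarith, by ring⟩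
  have : 0 ≤ (b + 2) * (k * (b * k + (b + 2) * (2 * b + 1))) := by positivity
  linarith

/-- Some step is short. -/
theorem exists_short_step {a : ℝ} (ha : 2 < a) {d : ℕ → ℝ} {e R : ℝ} (k : ℕ) (hR : 0 ≤ R)
    (h : ∑ i ∈ Finset.range (k + 1),
        (partialT (fun k => ((k : ℝ) + a) / a) i - (((i : ℝ) + a) / a) ^ 2) * d i ^ 2
      + partialT (fun k => ((k : ℝ) + a) / a) k * e ^ 2 ≤ R ^ 2) :
    (∃ i ≤ k, d i ≤ a * Real.sqrt 6 / Real.sqrt (a - 2) * (R / ((k + 1 : ℕ) : ℝ) ^ (1.5 : ℝ))) ∨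
      e ≤ a * Real.sqrt 6 / Real.sqrt (a - 2) * (R / ((k + 1 : ℕ) : ℝ) ^ (1.5 : ℝ)) := by
  have ha0 : 0 < a := by linarith
  have ha2 : 0 < a - 2 := by linarith
  set n : ℝ := ((k + 1 : ℕ) : ℝ) with hn
  have hn0 : 0 < n := by rw [hn]; positivity
  set δ := a * Real.sqrt 6 / Real.sqrt (a - 2) * (R / n ^ (1.5 : ℝ)) with hδ
  have hδ0 : 0 ≤ δ := by positivity
  have hpow : (n ^ (1.5 : ℝ)) ^ 2 = n ^ 3 := by
    rw [← Real.rpow_natCast, ← Real.rpow_mul hn0.le, ← Real.rpow_natCast]; norm_num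
  -- `δ` is the length for which the lower bound on the total weight exactly exhausts R².
  have hδ2 : (a - 2) * n ^ 3 / (6 * a ^ 2) * δ ^ 2 = R ^ 2 := by
    rw [hδ, mul_pow, div_pow, div_pow, mul_pow, Real.sq_sqrt (by norm_num), Real.sq_sqrt ha2.le,
      hpow]
    field_simp
  by_contra! hcon
  obtain ⟨h1, h2⟩ := hcon
  have hsum : ∑ i ∈ Finset.range (k + 1),
      (partialT (fun k => ((k : ℝ) + a) / a) i - (((i : ℝ) + a) / a) ^ 2) * δ ^ 2 ≤
      ∑ i ∈ Finset.range (k + 1),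
        (partialT (fun k => ((k : ℝ) + a) / a) i - (((i : ℝ) + a) / a) ^ 2) * d i ^ 2 := by
    refine Finset.sum_le_sum fun i hi => ?_
    have := sub_nonneg.2 (linear_weights_nonneg ha i)
    have := (h1 i (Nat.lt_succ_iff.1 (Finset.mem_range.1 hi))).le
    gcongr
  rw [← Finset.sum_mul] at hsum
  have hT : 0 < partialT (fun k => ((k : ℝ) + a) / a) k := by
    rw [partialT_linear ha0]; positivity
  -- Strictness comes from the extra step: T_k > 0, whereas the weight at i = 0 vanishes.
  have hlast : partialT (fun k => ((k : ℝ) + a) / a) k * δ ^ 2 <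
      partialT (fun k => ((k : ℝ) + a) / a) k * e ^ 2 := by gcongr
  have hw := mul_le_mul_of_nonneg_right (le_weights_linear ha k) (sq_nonneg δ)
  rw [hδ2] at hw
  linarith

end LinearSteps

/-! ### The convergence rate -/

theorem mainTheorem1 (n m : ℕ)
    (f : EuclideanSpace ℝ (Fin n) → EReal) (g : EuclideanSpace ℝ (Fin m) → EReal)
    (A : EuclideanSpace ℝ (Fin n) →L[ℝ] EuclideanSpace ℝ (Fin m))
    (σ : ℝ) (hσ : 0 < σ)
    (hf_proper : IsProperFun f) (hf_closed : LowerSemicontinuous f)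
    (hf_conv : IsStronglyConvexFun σ f)
    (hg_proper : IsProperFun g) (hg_closed : LowerSemicontinuous g)
    (hg_conv : IsConvexFun g)
    (yStar : EuclideanSpace ℝ (Fin m))
    (hyStar : IsMaxOn (dualFun f g A) Set.univ yStar)
    (a : ℝ) (ha : 2 < a)
    (L : ℕ → ℝ) (y w : ℕ → EuclideanSpace ℝ (Fin m))
    (hgen : IsGFDPG f g A (fun k => ((k : ℝ) + a) / a) L y w)
    (k : ℕ) (hk : 1 ≤ k)
    (L' : ℝ) (hL' : L k ≤ L') (hback : BacktrackCond f g A L' (y k)) :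
    ((∀ i ∈ Finset.Icc 1 k, IsPrimalZ g (y i) (proxZ f g A (L i) (w (i - 1)))) ∧
      IsPrimalZ g (proxGrad f g A L' (y k)) (proxZ f g A L' (y k)) ∧
      min
        ((Finset.Icc 1 k).inf fun i =>
          splitObj f g (primalX f A (y i)) (proxZ f g A (L i) (w (i - 1)))
            - dualFun f g A (y i))
        (splitObj f g (primalX f A (proxGrad f g A L' (y k))) (proxZ f g A L' (y k))
          - dualFun f g A (proxGrad f g A L' (y k)))
      ≤ ((a * Real.sqrt 6 / Real.sqrt (a - 2) * (L' + ‖A‖ ^ 2 / σ)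
          * (‖y 0 - yStar‖ + ‖yStar‖) * (‖y 0 - yStar‖ / (k : ℝ) ^ (1.5 : ℝ)) : ℝ) : EReal)) ∧
    (HasBoundedSubgradients g →
      min
        ((Finset.Icc 1 k).inf fun i =>
          primalObj f g A (primalX f A (y i)) - dualFun f g A (y i))
        (primalObj f g A (primalX f A (proxGrad f g A L' (y k)))
          - dualFun f g A (proxGrad f g A L' (y k)))
      ≤ ((a * Real.sqrt 6 / Real.sqrt (a - 2) * (L' + ‖A‖ ^ 2 / σ)
          * (‖y 0 - yStar‖ + ‖yStar‖ + subgradBound g)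
          * (‖y 0 - yStar‖ / (k : ℝ) ^ (1.5 : ℝ)) : ℝ) : EReal)) := by
  have ha0 : 0 < a := by linarith
  set t : ℕ → ℝ := fun k => ((k : ℝ) + a) / a with ht_def
  have ht : ∀ k, 0 < t k := fun k => by simp only [ht_def]; positivity
  have hsq : ∀ k, t k ^ 2 ≤ partialT t k := linear_weights_nonneg ha
  have hLpos : ∀ k, 0 < L k := fun k => by
    induction k with
    | zero => exact hgen.L_zero_pos
    | succ k ih => exact ih.trans_le (hgen.L_le k)
  have hL'pos : 0 < L' := (hLpos k).trans_le hL'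
  have hLmono : Monotone L := monotone_nat_of_le_succ hgen.L_le
  obtain ⟨K, rfl⟩ : ∃ K, k = K + 1 := ⟨k - 1, by omega⟩
  -- optimality conditions
  have hspec : ∀ {M : ℝ}, 0 < M → ∀ v, _ := fun {M} hM v =>
    proxGrad_spec hσ hf_proper hf_closed hf_conv hg_proper hg_closed hg_conv A (L := M) hM v
  have hGtop : ∀ {M : ℝ}, 0 < M → ∀ v, dualG g (proxGrad f g A M v) ≠ ⊤ := fun {M} hM v =>
    dualG_proxGrad_ne_top hσ hf_proper hf_closed hf_conv hg_proper hg_closed hg_conv A hM v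
  have hstar : ∀ {M : ℝ}, 0 < M → ∀ v, dualG g yStar ≠ ⊤ ∧
      dualObjReal f g A yStar ≤ dualObjReal f g A (proxGrad f g A M v) := by
    intro M hM v
    obtain ⟨s, hs, h⟩ := hspec hM v
    exact dualObjReal_le_of_isMaxOn hσ hf_proper hf_closed hf_conv hg_proper hs h hyStar
  have hdesc : ∀ {M : ℝ} {v : EuclideanSpace ℝ (Fin m)}, 0 < M → BacktrackCond f g A M v →
      ∀ {u}, dualG g u ≠ ⊤ → _ := fun {M v} hM hb {u} hu =>
    hb.descent hσ hf_proper hf_closed hf_conv hg_proper hg_closed hg_conv hM hu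
  -- the assumptions of the convergence analysis
  have h1 : ∀ k, L (k + 1) / 2 * (‖yStar - y (k + 1)‖ ^ 2 - ‖yStar - w k‖ ^ 2) ≤
      dualObjReal f g A yStar - dualObjReal f g A (y (k + 1)) := by
    intro k
    rw [hgen.y_succ k]
    -- Any proximal point witnesses that G(y_*) is finite; L 0 and the origin are an arbitrary
    -- choice.
    exact hdesc (hLpos _) (hgen.backtrack k) (hstar (hLpos 0) 0).1
  have h2 : ∀ k, L (k + 2) / 2 * (‖y (k + 1) - y (k + 2)‖ ^ 2 - ‖y (k + 1) - w (k + 1)‖ ^ 2) ≤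
      dualObjReal f g A (y (k + 1)) - dualObjReal f g A (y (k + 2)) := by
    intro k
    rw [hgen.y_succ (k + 1)]
    exact hdesc (hLpos _) (hgen.backtrack (k + 1)) (hgen.y_succ k ▸ hGtop (hLpos _) _)
  have hvs : ∀ k, dualObjReal f g A yStar ≤ dualObjReal f g A (y (k + 1)) := fun k => by
    rw [hgen.y_succ k]; exact (hstar (hLpos _) _).2
  have hlast : L' / 2 * (‖y (K + 1) - proxGrad f g A L' (y (K + 1))‖ ^ 2
      - ‖y (K + 1) - y (K + 1)‖ ^ 2) ≤ dualObjReal f g A (y (K + 1))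
        - dualObjReal f g A (proxGrad f g A L' (y (K + 1))) :=
    hdesc hL'pos hback (hgen.y_succ K ▸ hGtop (hLpos _) _)
  have hlastStar := hdesc hL'pos hback (hstar (hLpos 0) 0).1
  have hyb : ∀ k, ‖y k - yStar‖ ≤ ‖y 0 - yStar‖ :=
    norm_iterate_sub_le (v := fun k => dualObjReal f g A (y k)) ht hsq hLpos hgen.L_le hgen.w_zero hgen.w_succ h1 h2 hvs
  have hpb : ‖proxGrad f g A L' (y (K + 1)) - yStar‖ ≤ ‖y 0 - yStar‖ :=
    (norm_sub_le_of_prox_step hL'pos (hstar hL'pos _).2 hlastStar).trans (hyb _)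
  have hsum := accelerated_steps_sum_le (v := fun k => dualObjReal f g A (y k)) ht hLpos hgen.L_le
    hgen.w_zero hgen.w_succ h1 h2 hvs hL'
    (hstar hL'pos (y (K + 1))).2 (by simpa using hlast)
  have hshort := exists_short_step ha K (norm_nonneg _) hsum
  set δ := a * Real.sqrt 6 / Real.sqrt (a - 2) *
    (‖y 0 - yStar‖ / ((K + 1 : ℕ) : ℝ) ^ (1.5 : ℝ)) with hδ
  -- the gap at a proximal point reached by a short step
  have hnorm : ∀ {γ M : ℝ} {v : EuclideanSpace ℝ (Fin m)}, 0 ≤ γ → 0 < M → M ≤ L' →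
      ‖proxGrad f g A M v - yStar‖ ≤ ‖y 0 - yStar‖ → ‖proxGrad f g A M v - v‖ ≤ δ →
      (‖proxGrad f g A M v‖ + γ) *
        ‖A (primalX f A (proxGrad f g A M v)) - proxZ f g A M v‖ ≤
      a * Real.sqrt 6 / Real.sqrt (a - 2) * (L' + ‖A‖ ^ 2 / σ) *
        (‖y 0 - yStar‖ + ‖yStar‖ + γ) * (‖y 0 - yStar‖ / ((K + 1 : ℕ) : ℝ) ^ (1.5 : ℝ)) := by
    intro γ M v hγ hM hML hb hd
    have e1 : ‖proxGrad f g A M v‖ ≤ ‖y 0 - yStar‖ + ‖yStar‖ := by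
      have := norm_le_norm_sub_add (proxGrad f g A M v) yStar
      linarith
    have e2 : ‖A (primalX f A (proxGrad f g A M v)) - proxZ f g A M v‖ ≤
        (L' + ‖A‖ ^ 2 / σ) * δ := by
      refine (norm_map_primalX_sub_proxZ_le hσ hf_proper hf_closed hf_conv A hM v).trans ?_
      gcongr
    calc _ ≤ (‖y 0 - yStar‖ + ‖yStar‖ + γ) * ((L' + ‖A‖ ^ 2 / σ) * δ) := by gcongr
      _ = _ := by rw [hδ]; ring
  refine ⟨⟨?_, ?_, ?_⟩, ?_⟩
  · intro i hi
    obtain ⟨j, rfl⟩ : ∃ j, i = j + 1 := ⟨i - 1, by have := (Finset.mem_Icc.1 hi).1; omega⟩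
    obtain ⟨s, hs, h⟩ := hspec (hLpos (j + 1)) (w j)
    rw [Nat.add_sub_cancel, hgen.y_succ j]
    exact isPrimalZ_of_subgradient hg_proper hs h
  · obtain ⟨s, hs, h⟩ := hspec hL'pos (y (K + 1))
    exact isPrimalZ_of_subgradient hg_proper hs h
  · rcases hshort with ⟨i, hi, hd⟩ | hd
    · refine (min_le_left _ _).trans
        ((Finset.inf_le (Finset.mem_Icc.2 ⟨Nat.le_add_left 1 i, by omega⟩)).trans ?_)
      obtain ⟨s, hs, h⟩ := hspec (hLpos (i + 1)) (w i)
      have hb := hyb (i + 1)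
      rw [hgen.y_succ i] at hd hb
      rw [Nat.add_sub_cancel, hgen.y_succ i]
      refine (splitObj_sub_dualFun_le hσ hf_proper hf_closed hf_conv hs h).trans
        (EReal.coe_le_coe_iff.2 ?_)
      -- The split gap is the case γ = 0; the gap of H takes γ = γ_g.
      simpa using hnorm le_rfl (hLpos _) ((hLmono (by omega)).trans hL') hb hd
    · refine (min_le_right _ _).trans ?_
      obtain ⟨s, hs, h⟩ := hspec hL'pos (y (K + 1))
      refine (splitObj_sub_dualFun_le hσ hf_proper hf_closed hf_conv hs h).trans
        (EReal.coe_le_coe_iff.2 ?_)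
      simpa using hnorm le_rfl hL'pos le_rfl hpb hd
  · intro hbd
    have hγ : 0 ≤ subgradBound g := Real.sSup_nonneg (by
      rintro _ ⟨x, d, -, rfl⟩; exact norm_nonneg d)
    rcases hshort with ⟨i, hi, hd⟩ | hd
    · refine (min_le_left _ _).trans
        ((Finset.inf_le (Finset.mem_Icc.2 ⟨Nat.le_add_left 1 i, by omega⟩)).trans ?_)
      obtain ⟨s, hs, h⟩ := hspec (hLpos (i + 1)) (w i)
      have hb := hyb (i + 1)
      rw [hgen.y_succ i] at hd hb
      rw [hgen.y_succ i]
      exact (primalObj_sub_dualFun_le hσ hf_proper hf_closed hf_conv hg_proper hs h hbd).trans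
        (EReal.coe_le_coe_iff.2 (hnorm hγ (hLpos _) ((hLmono (by omega)).trans hL') hb hd))
    · refine (min_le_right _ _).trans ?_
      obtain ⟨s, hs, h⟩ := hspec hL'pos (y (K + 1))
      exact (primalObj_sub_dualFun_le hσ hf_proper hf_closed hf_conv hg_proper hs h hbd).trans
        (EReal.coe_le_coe_iff.2 (hnorm hγ hL'pos le_rfl hpb hd))
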